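/- For $x,y\in\{0,1\}^n$ let $HAM_n^t(x,y)=1$ if the Hamming distance of $x$ and $y$ is different from $t$, and $HAM_n^t(x,y)=0$ otherwise. Alice holds $x$ and Bob holds $y$. Let $BQC(f)$ be the least number of exchanged qubits in a quantum communication protocol without prior entanglement that computes $f$ with error at most $1/3$ on every input. Here each player has private qubits, initialized to the input and to $|0\rangle$; in a round one player applies a unitary transformation to the qubits in his possession and sends one of them to the other player; the unitaries and the sent qubits are fixed in advance; at the end one qubit is measured and gives the output. Let $BPC(f)$ be the least worst case number of exchanged bits in a classical randomized protocol with private random bits that computes $f$ with error at most $1/3$ on every input. Logarithms are to base $2$. Then: 1. There is a constant $c>0$ such that for every monotone increasing (that is, nondecreasing) function $t:\mathbb N\to\mathbb N$ with $t(n)\le n/2$ for all $n$, and for all $n\ge 1$, $$BQC\left(HAM_n^{t(n)}\right)\ \ge\ c\left(\frac{t(n)}{\log t(n)}+\log n\right),$$ where $t(n)/\log t(n)$ is read as $0$ if $t(n)\le 1$. 2. There is a constant $C>0$ such that for all $n\ge 2$ and all $t\ge 0$, $$BPC\left(HAM_n^t\right)\ \le\ C\cdot\max(t,1)\cdot\log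 n .$$ -/

import Mathlib

open scoped ENNReal

namespace CommComplexity

/-- Bit strings of length `n`. -/
abbrev Bits (n : ℕ) : Type := Fin n → Bool

/-- The Hamming distance problem: the value is `1` iff the distance of `x` and `y` is not `t`. -/
def HAM (n t : ℕ) (x y : Bits n) : Bool := decide (hammingDist x y ≠ t)

/-! ### Classical protocols with private coins -/

/-- A deterministic two-party protocol tree. At an inner node one of the players sends a bit
that depends on his own data; the bit selects the subtree (`p₁` for `true`, `p₀` for `false`) in
which the protocol goes on. A leaf carries the output, which hence is a function of the
communicated bits. -/
inductive Protocol (X Y : Type) : Type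
  | output (b : Bool) : Protocol X Y
  | alice (bit : X → Bool) (p₁ p₀ : Protocol X Y) : Protocol X Y
  | bob (bit : Y → Bool) (p₁ p₀ : Protocol X Y) : Protocol X Y

namespace Protocol

variable {X Y : Type}

/-- The output on given data of the two players. -/
def run : Protocol X Y → X → Y → Bool
  | output b, _, _ => b
  | alice bit p₁ p₀, x, y => if bit x then p₁.run x y else p₀.run x y
  | bob bit p₁ p₀, x, y => if bit y then p₁.run x y else p₀.run x y

/-- The worst case number of exchanged bits. -/
def cost : Protocol X Y → ℕ
  | output _ => 0
  | alice _ p₁ p₀ => max p₁.cost p₀.cost + 1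
  | bob _ p₁ p₀ => max p₁.cost p₀.cost + 1

end Protocol

/-- A randomized protocol on `n`-bit inputs: Alice and Bob have `a` resp. `b` private
independent fair random bits, and each of their messages may depend on the own input and the own
random bits only. -/
structure RandomizedProtocol (n : ℕ) where
  a : ℕ
  b : ℕ
  tree : Protocol (Bits n × Bits a) (Bits n × Bits b)

/-- The probability of the output `v` on inputs `x`, `y`, over the private coins. -/
noncomputable def RandomizedProtocol.prob {n : ℕ} (P : RandomizedProtocol n) (x y : Bits n)
    (v : Bool) : ℝ :=
  ((Finset.univ.filter fun r : Bits P.a × Bits P.b =>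
      P.tree.run (x, r.1) (y, r.2) = v).card : ℝ) / (Fintype.card (Bits P.a × Bits P.b) : ℝ)

/-- The classical (private coin) communication complexity with error `ε`. -/
noncomputable def BPCError (ε : ℝ) {n : ℕ} (f : Bits n → Bits n → Bool) : ℕ∞ :=
  ⨅ (P : RandomizedProtocol n) (_ : ∀ x y, 1 - ε ≤ P.prob x y (f x y)), (P.tree.cost : ℕ∞)

/-- The classical bounded error communication complexity. -/
noncomputable def BPC {n : ℕ} (f : Bits n → Bits n → Bool) : ℕ∞ := BPCError (1 / 3) f

/-! ### Quantum protocols (without prior entanglement) -/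

inductive Player : Type
  | alice : Player
  | bob : Player
  deriving DecidableEq

/-- The other player. -/
def Player.other : Player → Player
  | alice => bob
  | bob => alice

/-- Vectors in the state space of `m` qubits, in coordinates with respect to the
standard basis `|a⟩`, `a ∈ {0,1}^m`. -/
abbrev QState (m : ℕ) : Type := Bits m → ℂ

/-- The operator `U ⊗ 1` on `m` qubits, where `U` acts on the qubits in `S` and `1` is the
identity on the remaining qubits. -/
def localOp {m : ℕ} (S : Fin m → Prop) [DecidablePred S]
    (U : Matrix ({q : Fin m // S q} → Bool) ({q : Fin m // S q} → Bool) ℂ) :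
    Matrix (Bits m) (Bits m) ℂ :=
  Matrix.of fun a b =>
    if ∀ q, ¬ S q → a q = b q then U (fun q => a q) (fun q => b q) else 0

/-- The course of a quantum protocol on `m` qubits when qubit `q` currently is in the possession
of the player `own q`: either the protocol ends and some qubit is measured, or there is a
communication round, in which a player `p` applies a unitary transformation to the qubits in his
possession and then sends one of them to the other player. The players, unitaries and qubits are
fixed in advance. -/
inductive QRounds (m : ℕ) : (Fin m → Player) → Type
  | measure {own : Fin m → Player} (q : Fin m) : QRounds m own
  | round {own : Fin m → Player} (p : Player)
      (U : Matrix.unitaryGroup ({q : Fin m // own q = p} → Bool) ℂ)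
      (q : Fin m) (hq : own q = p)
      (rest : QRounds m (Function.update own q p.other)) : QRounds m own

namespace QRounds

variable {m : ℕ}

/-- The number of exchanged qubits. -/
def cost : {own : Fin m → Player} → QRounds m own → ℕ
  | _, measure _ => 0
  | _, round _ _ _ _ rest => rest.cost + 1

/-- The probability that the final measurement, in the standard basis, gives `v` when the global
state at present is `ψ`. -/
noncomputable def prob : {own : Fin m → Player} → QRounds m own → QState m → Bool → ℝ
  | _, measure q, ψ, v => ∑ a : Bits m, if a q = v then ‖ψ a‖ ^ 2 else 0
  | own, round p U _ _ rest, ψ, v =>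
      rest.prob ((localOp (fun q => own q = p) U.1).mulVec ψ) v

end QRounds

/-- A quantum protocol on `n`-bit inputs. There are `m` qubits, each initially in the possession
of one player; `inA` and `inB` tell which of them hold the inputs of Alice and Bob. -/
structure QProtocol (n : ℕ) where
  m : ℕ
  own : Fin m → Player
  inA : Fin n ↪ Fin m
  inB : Fin n ↪ Fin m
  own_inA : ∀ i, own (inA i) = Player.alice
  own_inB : ∀ i, own (inB i) = Player.bob
  rounds : QRounds m own

namespace QProtocol

variable {n : ℕ} (P : QProtocol n)

/-- The initial contents of the qubits: the inputs, and `0` everywhere else. -/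
def initBits (x y : Bits n) : Bits P.m := fun q =>
  decide (∃ i, (P.inA i = q ∧ x i = true) ∨ (P.inB i = q ∧ y i = true))

/-- The initial state, a standard basis state. -/
noncomputable def initState (x y : Bits n) : QState P.m := Pi.single (P.initBits x y) 1

/-- The probability of the output `v` on inputs `x`, `y`. -/
noncomputable def prob (x y : Bits n) (v : Bool) : ℝ := P.rounds.prob (P.initState x y) v

end QProtocol

/-- The quantum communication complexity with error `ε`. -/
noncomputable def BQCError (ε : ℝ) {n : ℕ} (f : Bits n → Bits n → Bool) : ℕ∞ :=
  ⨅ (P : QProtocol n) (_ : ∀ x y, 1 - ε ≤ P.prob x y (f x y)), (P.rounds.cost : ℕ∞)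

/-- The bounded error quantum communication complexity. -/
noncomputable def BQC {n : ℕ} (f : Bits n → Bits n → Bool) : ℕ∞ := BQCError (1 / 3) f

end CommComplexity

/-! Lower bounds. Sending a qubit splits a product state of the two players into two product states,
so each output probability of a protocol with `Q` qubits is a sum of `4 ^ Q` products of bounded
functions of `x` and of `y` (`form_product`, `isProductSum_prob`). Two arguments bound the number
`R` of terms from below.

For `log n`: appending `0^t` and `1^t` embeds equality on `n - t ≥ n / 2` bits. Rounding the factors
to a grid shows that few terms can separate only few points (`card_le_of_approx_eq`), so `Q` is at
least of order `log n`.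

For `t / log t`: restrict to strings of length `2t`, padded by zeros. The kernel `∏ (1 ± i)` is `4 ^
t` times a unitary matrix and hence nearly uncorrelated with products, but on the sphere of radius
`t` it is constant and of the modulus `2 ^ t` that it has everywhere. So a product sum that is
closer to the indicator than the density `≥ 1 / (2t)` of the sphere has exponentially many terms
(`le_of_approx_sphere`). The error is brought below `1 / (4t)` by a majority polynomial of degree
`O(log t)`, which is where the logarithm is lost.

Upper bound. Alice sends a random key and the fingerprint of `x` under it; Bob compares with all
strings at distance `t` from `y`. A union bound over at most `n ^ t` strings works in a field of
size about `n ^ (t + 1)`. -/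

namespace CommComplexity

/-! ### Short sums of product functions -/

/-- `f` is a sum of at most `R` products of a function of `x` and a function of `y`,
both bounded by `1` in absolute value. -/
def IsProductSum {X Y : Type*} (R : ℕ) (f : X → Y → ℂ) : Prop :=
  ∃ (ι : Type) (_ : Fintype ι) (α : ι → X → ℂ) (β : ι → Y → ℂ), Fintype.card ι ≤ R ∧
    (∀ r x, ‖α r x‖ ≤ 1) ∧ (∀ r y, ‖β r y‖ ≤ 1) ∧ ∀ x y, f x y = ∑ r, α r x * β r y

namespace IsProductSum

variable {X Y X' Y' : Type*} {R R' : ℕ} {f f' : X → Y → ℂ}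

theorem mono (h : IsProductSum R f) (hR : R ≤ R') : IsProductSum R' f := by
  obtain ⟨ι, _, α, β, hc, hα, hβ, hf⟩ := h
  exact ⟨ι, _, α, β, hc.trans hR, hα, hβ, hf⟩

theorem comp (h : IsProductSum R f) (u : X' → X) (v : Y' → Y) :
    IsProductSum R fun x y => f (u x) (v y) := by
  obtain ⟨ι, _, α, β, hc, hα, hβ, hf⟩ := h
  exact ⟨ι, _, fun r x => α r (u x), fun r y => β r (v y), hc, fun _ _ => hα _ _,
    fun _ _ => hβ _ _, fun _ _ => hf _ _⟩

theorem of_mul (α : X → ℂ) (β : Y → ℂ) (hα : ∀ x, ‖α x‖ ≤ 1) (hβ : ∀ y, ‖β y‖ ≤ 1) :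
    IsProductSum 1 fun x y => α x * β y :=
  ⟨Unit, inferInstance, fun _ => α, fun _ => β, by simp, fun _ => hα, fun _ => hβ, by simp⟩

theorem zero : IsProductSum 0 fun (_ : X) (_ : Y) => (0 : ℂ) :=
  ⟨Empty, inferInstance, fun _ _ => 0, fun _ _ => 0, by simp, by simp, by simp, by simp⟩

theorem one : IsProductSum 1 fun (_ : X) (_ : Y) => (1 : ℂ) := by
  simpa using of_mul (X := X) (Y := Y) (fun _ => 1) (fun _ => 1) (by simp) (by simp)

theorem add (h : IsProductSum R f) (h' : IsProductSum R' f') :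
    IsProductSum (R + R') fun x y => f x y + f' x y := by
  obtain ⟨ι, _, α, β, hc, hα, hβ, hf⟩ := h
  obtain ⟨ι', _, α', β', hc', hα', hβ', hf'⟩ := h'
  refine ⟨ι ⊕ ι', inferInstance, Sum.elim α α', Sum.elim β β', ?_, ?_, ?_, ?_⟩
  · simpa using add_le_add hc hc'
  · rintro (r | r) x
    exacts [hα _ _, hα' _ _]
  · rintro (r | r) x
    exacts [hβ _ _, hβ' _ _]
  · simp [hf, hf']

theorem mul (h : IsProductSum R f) (h' : IsProductSum R' f') :
    IsProductSum (R * R') fun x y => f x y * f' x y := by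
  obtain ⟨ι, _, α, β, hc, hα, hβ, hf⟩ := h
  obtain ⟨ι', _, α', β', hc', hα', hβ', hf'⟩ := h'
  refine ⟨ι × ι', inferInstance, fun r x => α r.1 x * α' r.2 x, fun r y => β r.1 y * β' r.2 y,
    ?_, ?_, ?_, ?_⟩
  · simpa using Nat.mul_le_mul hc hc'
  · intro r x
    simpa using mul_le_one₀ (hα r.1 x) (norm_nonneg _) (hα' r.2 x)
  · intro r x
    simpa using mul_le_one₀ (hβ r.1 x) (norm_nonneg _) (hβ' r.2 x)
  · intro x y
    simp only [hf, hf']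
    rw [Finset.sum_mul_sum, Fintype.sum_prod_type]
    exact Finset.sum_congr rfl fun i _ => Finset.sum_congr rfl fun j _ => by ring

theorem pow (h : IsProductSum R f) (k : ℕ) : IsProductSum (R ^ k) fun x y => f x y ^ k := by
  induction k with
  | zero => simpa using one
  | succ k ih => simpa only [pow_succ] using ih.mul h

theorem sum {κ : Type*} (s : Finset κ) {R : κ → ℕ} {f : κ → X → Y → ℂ}
    (h : ∀ k ∈ s, IsProductSum (R k) (f k)) :
    IsProductSum (∑ k ∈ s, R k) fun x y => ∑ k ∈ s, f k x y := by
  classical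
  induction s using Finset.induction_on with
  | empty => simpa using zero
  | insert a s ha ih =>
    simp only [Finset.sum_insert ha]
    exact (h a (by simp)).add (ih fun k hk => h k (by simp [hk]))

/-- The factors must stay bounded by `1`, so an integer coefficient is paid for by repeating terms.
-/
theorem natCast_mul (h : IsProductSum R f) (k : ℕ) :
    IsProductSum (k * R) fun x y => k * f x y := by
  simpa using sum (Finset.range k) fun _ _ => h

/-- The terms of the binomial expansion of `(f + f') ^ N` with index in a given set. -/
theorem binomial (h : IsProductSum R f) (h' : IsProductSum R f') (N : ℕ) (s : Finset ℕ)
    (hs : s ⊆ Finset.range (N + 1)) :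
    IsProductSum ((2 * R) ^ N)
      fun x y => ∑ j ∈ s, ((N.choose j : ℕ) : ℂ) * (f x y ^ j * f' x y ^ (N - j)) := by
  refine (sum s fun j _ => ((h.pow j).mul (h'.pow (N - j))).natCast_mul (N.choose j)).mono ?_
  calc ∑ j ∈ s, N.choose j * (R ^ j * R ^ (N - j))
      ≤ ∑ j ∈ Finset.range (N + 1), N.choose j * (R ^ j * R ^ (N - j)) :=
        Finset.sum_le_sum_of_subset hs
    _ = (2 * R) ^ N := by
        rw [two_mul, add_pow]
        refine Finset.sum_congr rfl fun j _ => ?_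
        simp only [Nat.cast_id]; ring

end IsProductSum

/-! ### Amplification -/

/-- The probability of at least `m` successes in `2 * m` independent trials,
with `p` and `q` the probabilities of success and failure. -/
noncomputable def majority (m : ℕ) (p q : ℝ) : ℝ :=
  ∑ j ∈ Finset.Icc m (2 * m), ((2 * m).choose j : ℝ) * (p ^ j * q ^ (2 * m - j))

/-- Trading surplus factors `p` for `q` bounds each product by `(p * q) ^ m`, and the binomial
coefficients sum to at most `4 ^ m`. The exponent `e` is left open to serve both tails. -/
theorem sum_choose_mul_pow_le (m : ℕ) {p q : ℝ} (hp : 0 ≤ p) (hpq : p ≤ q)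
    (h : p * q ≤ 2 / 9) (s : Finset ℕ) (hs : s ⊆ Finset.range (2 * m + 1)) (e : ℕ → ℕ)
    (he : ∀ j ∈ s, m ≤ e j ∧ e j ≤ 2 * m) :
    ∑ j ∈ s, ((2 * m).choose j : ℝ) * (p ^ e j * q ^ (2 * m - e j)) ≤ (8 / 9) ^ m := by
  have hq : 0 ≤ q := hp.trans hpq
  have key : ∀ j ∈ s, p ^ e j * q ^ (2 * m - e j) ≤ (2 / 9) ^ m := by
    intro j hj
    obtain ⟨k, hk⟩ := Nat.exists_eq_add_of_le (he j hj).1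
    have hk' : k + (2 * m - e j) = m := by have := (he j hj).2; omega
    calc p ^ e j * q ^ (2 * m - e j) = p ^ m * (p ^ k * q ^ (2 * m - e j)) := by
          rw [hk, pow_add, mul_assoc]
      _ ≤ p ^ m * (q ^ k * q ^ (2 * m - e j)) := by gcongr
      _ = (p * q) ^ m := by rw [← pow_add, hk', mul_pow]
      _ ≤ (2 / 9) ^ m := by gcongr
  calc ∑ j ∈ s, ((2 * m).choose j : ℝ) * (p ^ e j * q ^ (2 * m - e j))
      ≤ ∑ j ∈ s, ((2 * m).choose j : ℝ) * (2 / 9) ^ m :=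
        Finset.sum_le_sum fun j hj => by have := key j hj; gcongr
    _ ≤ ∑ j ∈ Finset.range (2 * m + 1), ((2 * m).choose j : ℝ) * (2 / 9) ^ m :=
        Finset.sum_le_sum_of_subset_of_nonneg hs fun _ _ _ => by positivity
    _ = (8 / 9) ^ m := by
        rw [← Finset.sum_mul]
        have : ∑ j ∈ Finset.range (2 * m + 1), ((2 * m).choose j : ℝ) = 4 ^ m := by
          rw [← Nat.cast_sum, Nat.sum_range_choose, pow_mul]; norm_num
        rw [this, ← mul_pow]; norm_num

theorem majority_nonneg (m : ℕ) {p q : ℝ} (hp : 0 ≤ p) (hq : 0 ≤ q) : 0 ≤ majority m p q :=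
  Finset.sum_nonneg fun _ _ => by positivity

theorem majority_le (m : ℕ) {p q : ℝ} (hp : 0 ≤ p) (h1 : p + q = 1) (h : p ≤ 1 / 3) :
    majority m p q ≤ (8 / 9) ^ m := by
  have hq : q = 1 - p := by linarith
  refine sum_choose_mul_pow_le m hp (by linarith) (by subst hq; nlinarith) _ ?_ id ?_
  · intro j hj; simp at hj ⊢; omega
  · intro j hj; simpa using hj

theorem one_sub_majority (m : ℕ) {p q : ℝ} (h1 : p + q = 1) :
    1 - majority m p q =
      ∑ j ∈ Finset.range m, ((2 * m).choose j : ℝ) * (q ^ (2 * m - j) * p ^ j) := by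
  have h : (p + q) ^ (2 * m) = 1 := by rw [h1, one_pow]
  rw [add_pow] at h
  rw [← h, majority, sub_eq_iff_eq_add]
  have hd : Finset.range (2 * m + 1) = Finset.range m ∪ Finset.Icc m (2 * m) := by
    ext j; simp; omega
  rw [hd, Finset.sum_union]
  · congr 1 <;> exact Finset.sum_congr rfl fun j _ => by ring
  · rw [Finset.disjoint_left]; intro j; simp; omega

theorem majority_le_one (m : ℕ) {p q : ℝ} (hp : 0 ≤ p) (hq : 0 ≤ q) (h1 : p + q = 1) :
    majority m p q ≤ 1 := by
  have : 0 ≤ 1 - majority m p q := by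
    rw [one_sub_majority m h1]
    exact Finset.sum_nonneg fun _ _ => by positivity
  linarith

theorem one_sub_majority_le (m : ℕ) {p q : ℝ} (hq : 0 ≤ q) (h1 : p + q = 1) (h : q ≤ 1 / 3) :
    1 - majority m p q ≤ (8 / 9) ^ m := by
  have hp : p = 1 - q := by linarith
  rw [one_sub_majority m h1]
  -- Fewer than `m` successes mean more than `m` failures: the same bound with `p` and `q`
  -- exchanged.
  have := sum_choose_mul_pow_le m hq (q := p) (by linarith) (by subst hp; nlinarith)
    (Finset.range m) (by intro j hj; simp at hj ⊢; omega) (fun j => 2 * m - j)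
    (by intro j hj; simp at hj; omega)
  refine le_trans (le_of_eq ?_) this
  refine Finset.sum_congr rfl fun j hj => ?_
  have : 2 * m - (2 * m - j) = j := by simp at hj; omega
  rw [this]

/-- Amplification acts on the probabilities, as a polynomial, so no repeated quantum protocol has to
be built. -/
theorem IsProductSum.majority {X Y : Type*} {R : ℕ} {p q : X → Y → ℝ}
    (hp : IsProductSum R fun x y => (p x y : ℂ)) (hq : IsProductSum R fun x y => (q x y : ℂ))
    (m : ℕ) :
    IsProductSum ((2 * R) ^ (2 * m)) fun x y => (CommComplexity.majority m (p x y) (q x y) : ℂ) := by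
  have := hp.binomial hq (2 * m) (Finset.Icc m (2 * m)) (by intro j hj; simp at hj ⊢; omega)
  simpa [CommComplexity.majority] using this

/-! ### The bound on correlations with a phase kernel -/

open Complex in
/-- The tensor power of `[[1 + i, 1 - i], [1 - i, 1 + i]]`. -/
noncomputable def phaseKernel {n : ℕ} (x y : Bits n) : ℂ :=
  ∏ i, if x i = y i then 1 + I else 1 - I

open Complex in
-- One coordinate suffices: `(1 + i)^2 + (1 - i)^2 = 0` and `|1 + i|^2 + |1 - i|^2 = 4`. So the
-- kernel is `2 ^ n` times a unitary matrix.
theorem phaseKernel_orthogonal {n : ℕ} (y y' : Bits n) :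
    ∑ x, phaseKernel x y * (starRingEnd ℂ) (phaseKernel x y') = if y = y' then 4 ^ n else 0 := by
  simp only [phaseKernel, map_prod, ← Finset.prod_mul_distrib]
  rw [← Fintype.prod_sum (fun i b => (if b = y i then (1 : ℂ) + I else 1 - I) *
    (starRingEnd ℂ) (if b = y' i then (1 : ℂ) + I else 1 - I))]
  have h : ∀ i, ∑ b : Bool, (if b = y i then (1 : ℂ) + I else 1 - I) *
      (starRingEnd ℂ) (if b = y' i then (1 : ℂ) + I else 1 - I) =
      if y i = y' i then 4 else 0 := by
    intro i
    have hI : I * I = -1 := I_mul_I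
    cases hy : y i <;> cases hy' : y' i <;> simp <;> ring_nf <;> simp <;> norm_num
  simp only [h]
  split_ifs with hy
  · subst hy; simp
  · obtain ⟨i, hi⟩ := Function.ne_iff.1 hy
    exact Finset.prod_eq_zero (Finset.mem_univ i) (by simp [hi])

theorem sum_norm_sq_phaseKernel {n : ℕ} (β : Bits n → ℂ) :
    ∑ x, ‖∑ y, phaseKernel x y * β y‖ ^ 2 = 4 ^ n * ∑ y, ‖β y‖ ^ 2 := by
  have : (∑ x, ‖∑ y, phaseKernel x y * β y‖ ^ 2 : ℂ) = 4 ^ n * ∑ y, (‖β y‖ : ℂ) ^ 2 := by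
    simp only [← Complex.mul_conj', map_sum, map_mul, Finset.sum_mul_sum]
    rw [Finset.sum_comm]
    simp only [Finset.mul_sum]
    refine Finset.sum_congr rfl fun y _ => ?_
    rw [Finset.sum_comm]
    have : ∀ y', ∑ x, phaseKernel x y * β y *
        ((starRingEnd ℂ) (phaseKernel x y') * (starRingEnd ℂ) (β y')) =
        if y = y' then 4 ^ n * (β y * (starRingEnd ℂ) (β y')) else 0 := by
      intro y'
      have e : ∀ x, phaseKernel x y * β y *
        ((starRingEnd ℂ) (phaseKernel x y') * (starRingEnd ℂ) (β y')) =
        (phaseKernel x y * (starRingEnd ℂ) (phaseKernel x y')) *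
          (β y * (starRingEnd ℂ) (β y')) := fun x => by ring
      simp only [e, ← Finset.sum_mul, phaseKernel_orthogonal]
      split_ifs <;> simp
    simp [this]
  exact_mod_cast this

/-- Cauchy–Schwarz with operator norm `2 ^ n` and vectors of norm at most `2 ^ (n / 2)`. This gains
`2 ^ (n / 2)` over the trivial estimate. -/
theorem norm_sum_mul_phaseKernel_le {n : ℕ} (α β : Bits n → ℂ) (hα : ∀ x, ‖α x‖ ≤ 1)
    (hβ : ∀ y, ‖β y‖ ≤ 1) : ‖∑ x, ∑ y, α x * β y * phaseKernel x y‖ ≤ 4 ^ n := by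
  have bound : ∀ γ : Bits n → ℂ, (∀ x, ‖γ x‖ ≤ 1) → ∑ x, ‖γ x‖ ^ 2 ≤ 2 ^ n := by
    intro γ hγ
    calc ∑ x, ‖γ x‖ ^ 2 ≤ ∑ _x : Bits n, (1 : ℝ) :=
          Finset.sum_le_sum fun x _ => pow_le_one₀ (norm_nonneg _) (hγ x)
      _ = 2 ^ n := by simp
  have e : ∑ x, ∑ y, α x * β y * phaseKernel x y = ∑ x, α x * ∑ y, phaseKernel x y * β y := by
    refine Finset.sum_congr rfl fun x _ => ?_
    rw [Finset.mul_sum]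
    exact Finset.sum_congr rfl fun y _ => by ring
  rw [e]
  refine le_of_sq_le_sq ?_ (by positivity)
  calc ‖∑ x, α x * ∑ y, phaseKernel x y * β y‖ ^ 2
      ≤ (∑ x, ‖α x‖ * ‖∑ y, phaseKernel x y * β y‖) ^ 2 := by
        gcongr
        exact (norm_sum_le _ _).trans (le_of_eq (by simp))
    _ ≤ (∑ x, ‖α x‖ ^ 2) * ∑ x, ‖∑ y, phaseKernel x y * β y‖ ^ 2 :=
        Finset.sum_mul_sq_le_sq_mul_sq _ _ _
    _ ≤ 2 ^ n * (4 ^ n * 2 ^ n) := by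
        rw [sum_norm_sq_phaseKernel]
        have := bound α hα
        have := bound β hβ
        gcongr
    _ = (4 ^ n) ^ 2 := by
        rw [← pow_mul, mul_comm n 2, pow_mul, ← mul_pow, ← mul_pow]; norm_num

theorem IsProductSum.norm_sum_mul_phaseKernel_le {n R : ℕ} {f : Bits n → Bits n → ℂ}
    (h : IsProductSum R f) : ‖∑ x, ∑ y, f x y * phaseKernel x y‖ ≤ R * 4 ^ n := by
  obtain ⟨ι, _, α, β, hc, hα, hβ, hf⟩ := h
  have e : ∑ x, ∑ y, f x y * phaseKernel x y =
      ∑ r, ∑ x, ∑ y, α r x * β r y * phaseKernel x y := by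
    simp only [hf, Finset.sum_mul]
    rw [Finset.sum_comm]
    rw [Finset.sum_comm]
    rw [Finset.sum_congr rfl fun x _ => Finset.sum_comm]
    rw [Finset.sum_comm]
  rw [e]
  calc ‖∑ r, ∑ x, ∑ y, α r x * β r y * phaseKernel x y‖
      ≤ ∑ _r : ι, (4 : ℝ) ^ n := norm_sum_le_of_le _ fun r _ =>
        CommComplexity.norm_sum_mul_phaseKernel_le _ _ (hα r) (hβ r)
    _ = Fintype.card ι * 4 ^ n := by simp
    _ ≤ R * 4 ^ n := by gcongr

/-! ### Hamming spheres -/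

theorem card_hammingDist_eq {n : ℕ} (x : Bits n) (t : ℕ) :
    (Finset.univ.filter fun y : Bits n => hammingDist x y = t).card = n.choose t := by
  have : (Finset.powersetCard t (Finset.univ : Finset (Fin n))).card = n.choose t := by simp
  rw [← this]
  refine Finset.card_nbij' (fun y => Finset.univ.filter fun i => x i ≠ y i)
    (fun s i => if i ∈ s then !(x i) else x i) ?_ ?_ ?_ ?_
  · intro y hy
    simpa [hammingDist, Finset.mem_powersetCard] using hy
  · intro s hs
    simp only [Finset.coe_filter, Set.mem_ofPred_eq, Finset.mem_univ, true_and]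
    have hs := (Finset.mem_powersetCard.1 hs).2
    rw [← hs, hammingDist]
    congr 1
    ext i
    by_cases hi : i ∈ s <;> simp [hi]
  · intro y _
    funext i
    by_cases hi : x i = y i
    · simp [hi]
    · simp [hi]
      revert hi; cases x i <;> cases y i <;> simp
  · intro s _
    ext i
    by_cases hi : i ∈ s <;> simp [hi]

open Complex in
theorem norm_phaseKernel {t : ℕ} (x y : Bits (2 * t)) : ‖phaseKernel x y‖ = 2 ^ t := by
  have h : ∀ i, ‖if x i = y i then (1 : ℂ) + I else 1 - I‖ = √2 := by
    intro i
    have h1 : ‖(1 : ℂ) + I‖ = √2 := by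
      rw [Complex.norm_def]; simp [Complex.normSq_apply]; norm_num
    have h2 : ‖(1 : ℂ) - I‖ = √2 := by
      rw [Complex.norm_def]; simp [Complex.normSq_apply]; norm_num
    split_ifs <;> assumption
  rw [phaseKernel, norm_prod, Finset.prod_congr rfl fun i _ => h i]
  simp [pow_mul]

open Complex in
-- Agreements and differences are equally many and `(1 + i) * (1 - i) = 2`; the phases cancel
-- exactly on this sphere.
theorem phaseKernel_of_hammingDist_eq {t : ℕ} {x y : Bits (2 * t)} (h : hammingDist x y = t) :
    phaseKernel x y = 2 ^ t := by
  have hc : (Finset.univ.filter fun i => ¬ x i = y i).card = t := h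
  have hc' : (Finset.univ.filter fun i => x i = y i).card = t := by
    have := Finset.card_filter_add_card_filter_not (s := Finset.univ) (fun i => x i = y i)
    rw [hc, Finset.card_univ, Fintype.card_fin] at this
    omega
  rw [phaseKernel, Finset.prod_ite, Finset.prod_const, Finset.prod_const, hc, hc', ← mul_pow]
  congr 1
  have : I * I = -1 := I_mul_I
  linear_combination -this

/-- A sum of `R` product functions that approximates the indicator of the Hamming distance `t`
on strings of length `2 * t` up to `ε` has an exponential number of terms, if `ε` is below the
density of that set. -/
theorem IsProductSum.le_of_approx_sphere {t R : ℕ} {f : Bits (2 * t) → Bits (2 * t) → ℂ}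
    (h : IsProductSum R f) {ε : ℝ}
    (hf : ∀ x y, ‖f x y - if hammingDist x y = t then 1 else 0‖ ≤ ε) :
    2 ^ t * ((Nat.centralBinom t : ℝ) / 4 ^ t - ε) ≤ R := by
  set g : Bits (2 * t) → Bits (2 * t) → ℂ := fun x y => if hammingDist x y = t then 1 else 0
    with hg
  -- Three correlations with the kernel are compared: the indicator without cancellation (`h1`), the
  -- error by the triangle inequality (`h2`), and `f` by the product sum bound (`h3`).
  have h1 : ∑ x, ∑ y, g x y * phaseKernel x y = 4 ^ t * t.centralBinom * 2 ^ t := by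
    have : ∀ x : Bits (2 * t), ∑ y, g x y * phaseKernel x y = t.centralBinom * 2 ^ t := by
      intro x
      have e : ∀ y, g x y * phaseKernel x y = if hammingDist x y = t then 2 ^ t else 0 := by
        intro y
        by_cases hy : hammingDist x y = t
        · simp [hg, hy, phaseKernel_of_hammingDist_eq]
        · simp [hg, hy]
      simp only [e, ← Finset.sum_filter, Finset.sum_const, card_hammingDist_eq,
        Nat.centralBinom, nsmul_eq_mul]
    simp only [this, Finset.sum_const, Finset.card_univ, Fintype.card_fun, Fintype.card_bool,
      Fintype.card_fin, nsmul_eq_mul, pow_mul]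
    norm_num
    ring
  have h2 : ‖∑ x, ∑ y, (f x y - g x y) * phaseKernel x y‖ ≤ 16 ^ t * ε * 2 ^ t := by
    calc ‖∑ x, ∑ y, (f x y - g x y) * phaseKernel x y‖
        ≤ ∑ _x : Bits (2 * t), ∑ _y : Bits (2 * t), ε * 2 ^ t := by
          refine norm_sum_le_of_le _ fun x _ => norm_sum_le_of_le _ fun y _ => ?_
          rw [norm_mul, norm_phaseKernel]
          exact mul_le_mul_of_nonneg_right (hf x y) (by positivity)
      _ = 16 ^ t * ε * 2 ^ t := by
          simp only [Finset.sum_const, Finset.card_univ, Fintype.card_fun, Fintype.card_bool,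
            Fintype.card_fin, nsmul_eq_mul, pow_mul]
          have : (16 : ℝ) ^ t = 4 ^ t * 4 ^ t := by rw [← mul_pow]; norm_num
          rw [this]; norm_num; ring
  have h3 := h.norm_sum_mul_phaseKernel_le
  have e : ∑ x, ∑ y, (f x y - g x y) * phaseKernel x y =
      ∑ x, ∑ y, f x y * phaseKernel x y - ∑ x, ∑ y, g x y * phaseKernel x y := by
    simp only [sub_mul, Finset.sum_sub_distrib]
  have h4 := norm_sub_norm_le (∑ x, ∑ y, g x y * phaseKernel x y)
    (∑ x, ∑ y, f x y * phaseKernel x y)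
  rw [norm_sub_rev, ← e] at h4
  have h5 : ‖∑ x, ∑ y, g x y * phaseKernel x y‖ = 4 ^ t * t.centralBinom * 2 ^ t := by
    rw [h1]; simp
  rw [h5] at h4
  have h16 : (4 : ℝ) ^ (2 * t) = 16 ^ t := by rw [pow_mul]; norm_num
  rw [h16] at h3
  have h44 : (16 : ℝ) ^ t = 4 ^ t * 4 ^ t := by rw [← mul_pow]; norm_num
  have h6 : 4 ^ t * t.centralBinom * 2 ^ t - 16 ^ t * ε * 2 ^ t ≤ R * (16 : ℝ) ^ t := by linarith
  have h7 : 16 ^ t * (2 ^ t * ((Nat.centralBinom t : ℝ) / 4 ^ t - ε)) ≤ 16 ^ t * (R : ℝ) := by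
    have : 16 ^ t * (2 ^ t * ((Nat.centralBinom t : ℝ) / 4 ^ t - ε)) =
        4 ^ t * t.centralBinom * 2 ^ t - 16 ^ t * ε * 2 ^ t := by
      rw [h44]; field_simp
    linarith
  exact le_of_mul_le_mul_left h7 (by positivity)

/-! ### Product sums that approximate the equality function -/

theorem abs_sub_le_of_floor_eq {K : ℕ} (hK : 0 < K) {a b : ℝ} (h : ⌊K * a⌋ = ⌊K * b⌋) :
    |a - b| ≤ 1 / K := by
  have := (Int.abs_sub_lt_one_of_floor_eq_floor h).le
  have hK' : (0 : ℝ) < K := by exact_mod_cast hK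
  rw [← mul_sub, abs_mul, abs_of_pos hK'] at this
  rw [le_div_iff₀ hK']; linarith

theorem floor_mem_Icc {K : ℕ} {a : ℝ} (h : |a| ≤ 1) :
    ⌊K * a⌋ ∈ Finset.Icc (-K : ℤ) K := by
  rw [abs_le] at h
  have hK : (0 : ℝ) ≤ K := by positivity
  rw [Finset.mem_Icc, Int.le_floor]
  refine ⟨by push_cast; nlinarith, ?_⟩
  have : (⌊K * a⌋ : ℝ) ≤ K := (Int.floor_le _).trans (by nlinarith)
  exact_mod_cast this

theorem IsProductSum.card_le_of_approx_eq {X : Type*} [Fintype X] {R : ℕ} (hR : 0 < R)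
    {f : X → X → ℂ} (h : IsProductSum R f) (h1 : ∀ x, 2 / 3 ≤ (f x x).re)
    (h0 : ∀ x y, x ≠ y → (f x y).re ≤ 1 / 3) :
    Fintype.card X ≤ (14 * R + 1) ^ (2 * R) := by
  obtain ⟨ι, _, α, β, hc, hα, hβ, hf⟩ := h
  -- Points in the same grid cell give values at most `2 * R / K = 2 / 7` apart, below the gap `1 /
  -- 3`.
  set K := 7 * R with hK
  have hK0 : 0 < K := by omega
  classical
  let F : X → (ι → Finset.Icc (-K : ℤ) K × Finset.Icc (-K : ℤ) K) := fun x r =>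
    (⟨⌊K * (α r x).re⌋, floor_mem_Icc ((Complex.abs_re_le_norm _).trans (hα r x))⟩,
      ⟨⌊K * (α r x).im⌋, floor_mem_Icc ((Complex.abs_im_le_norm _).trans (hα r x))⟩)
  have hF : Function.Injective F := by
    intro x y hxy
    by_contra hne
    have hd : ∀ r, ‖α r x - α r y‖ ≤ 2 / K := by
      intro r
      have hr := congrFun hxy r
      have e1 := abs_sub_le_of_floor_eq hK0 (congrArg (fun z => (z.1 : ℤ)) hr)
      have e2 := abs_sub_le_of_floor_eq hK0 (congrArg (fun z => (z.2 : ℤ)) hr)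
      calc ‖α r x - α r y‖ ≤ |(α r x - α r y).re| + |(α r x - α r y).im| :=
            Complex.norm_le_abs_re_add_abs_im _
        _ ≤ 1 / K + 1 / K := by
            rw [Complex.sub_re, Complex.sub_im]; exact add_le_add e1 e2
        _ = 2 / K := by ring
    have hb : ‖f x x - f y x‖ ≤ 2 / 7 := by
      rw [hf, hf, ← Finset.sum_sub_distrib]
      calc ‖∑ r, (α r x * β r x - α r y * β r x)‖ ≤ ∑ _r : ι, (2 / K : ℝ) := by
            refine norm_sum_le_of_le _ fun r _ => ?_
            rw [← sub_mul, norm_mul]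
            exact (mul_le_of_le_one_right (norm_nonneg _) (hβ r x)).trans (hd r)
        _ = Fintype.card ι * (2 / K : ℝ) := by simp
        _ ≤ R * (2 / K : ℝ) := by gcongr
        _ = 2 / 7 := by rw [hK]; push_cast; field_simp
    have := (Complex.re_le_norm (f x x - f y x)).trans hb
    rw [Complex.sub_re] at this
    have := h1 x
    have := h0 y x (Ne.symm hne)
    linarith
  have hB : Fintype.card (Finset.Icc (-K : ℤ) K) = 14 * R + 1 := by
    simp only [Fintype.card_coe, Int.card_Icc]; omega
  calc Fintype.card X ≤ Fintype.card (ι → Finset.Icc (-K : ℤ) K × Finset.Icc (-K : ℤ) K) :=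
        Fintype.card_le_of_injective F hF
    _ = (14 * R + 1) ^ (2 * Fintype.card ι) := by
        rw [Fintype.card_fun, Fintype.card_prod, hB, pow_mul, sq]
    _ ≤ (14 * R + 1) ^ (2 * R) := Nat.pow_le_pow_right (by omega) (by omega)

/-! ### Local operations -/

theorem sum_norm_sq_mulVec_unitary {κ : Type*} [Fintype κ] [DecidableEq κ]
    (U : Matrix.unitaryGroup κ ℂ) (φ : κ → ℂ) :
    ∑ u, ‖(U.1.mulVec φ) u‖ ^ 2 = ∑ u, ‖φ u‖ ^ 2 := by
  have h : ∀ χ : κ → ℂ, ((∑ u, ‖χ u‖ ^ 2 : ℝ) : ℂ) = star χ ⬝ᵥ χ := by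
    intro χ
    simp [dotProduct, Complex.conj_mul']
  have hU : U.1.conjTranspose * U.1 = 1 := Matrix.mem_unitaryGroup_iff'.1 U.2
  have : ((∑ u, ‖(U.1.mulVec φ) u‖ ^ 2 : ℝ) : ℂ) = ((∑ u, ‖φ u‖ ^ 2 : ℝ) : ℂ) := by
    rw [h, h, Matrix.star_mulVec, Matrix.dotProduct_mulVec, Matrix.vecMul_vecMul, hU,
      Matrix.vecMul_one]
  exact_mod_cast this

section localOp

variable {m : ℕ} (S : Fin m → Prop) [DecidablePred S]

/-- The bit string that is given by `u` on `S` and by `a` elsewhere. -/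
def glue (u : {q : Fin m // S q} → Bool) (a : Bits m) : Bits m := fun q =>
  if h : S q then u ⟨q, h⟩ else a q

theorem localOp_mulVec (U : Matrix ({q : Fin m // S q} → Bool) ({q : Fin m // S q} → Bool) ℂ)
    (ψ : QState m) (a : Bits m) :
    (localOp S U).mulVec ψ a = ∑ u, U (fun q => a q) u * ψ (glue S u a) := by
  simp only [Matrix.mulVec, dotProduct, localOp, Matrix.of_apply, ite_mul, zero_mul,
    ← Finset.sum_filter]
  refine Finset.sum_nbij' (fun b q => b q) (fun u => glue S u a) ?_ ?_ ?_ ?_ ?_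
  · simp
  · intro u _
    simp only [Finset.mem_filter, Finset.mem_univ, true_and]
    intro q hq
    simp [glue, hq]
  · intro b hb
    simp only [Finset.mem_filter, Finset.mem_univ, true_and] at hb
    funext q
    by_cases hq : S q <;> simp [glue, hq, hb]
  · intro u _
    funext q
    simp [glue, q.2]
  · intro b hb
    simp only [Finset.mem_filter, Finset.mem_univ, true_and] at hb
    congr 2
    funext q
    by_cases hq : S q <;> simp [glue, hq, hb]

theorem sum_norm_sq_localOp (U : Matrix.unitaryGroup ({q : Fin m // S q} → Bool) ℂ)
    (ψ : QState m) :
    ∑ a, ‖(localOp S U.1).mulVec ψ a‖ ^ 2 = ∑ a, ‖ψ a‖ ^ 2 := by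
  let e := Equiv.piEquivPiSubtypeProd S (fun _ => Bool)
  rw [← e.symm.sum_comp, ← e.symm.sum_comp (fun a => ‖ψ a‖ ^ 2), Fintype.sum_prod_type_right,
    Fintype.sum_prod_type_right]
  -- For fixed contents `w` of the other qubits, the operator acts as `U`.
  refine Finset.sum_congr rfl fun w _ => ?_
  rw [← sum_norm_sq_mulVec_unitary U fun u => ψ (e.symm (u, w))]
  refine Finset.sum_congr rfl fun u _ => ?_
  rw [localOp_mulVec]
  congr 2
  refine Finset.sum_congr rfl fun u' _ => ?_
  congr 2
  · exact congrArg (fun z => U.1 z u') (funext fun q => by simp [e, q.2])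
  · funext q
    by_cases hq : S q <;> simp [e, glue, hq]

end localOp

/-! ### Product states -/

theorem Player.eq_bob_of_ne {p : Player} (h : p ≠ Player.alice) : p = Player.bob := by
  cases p <;> simp_all

/-- Bit strings on the qubits of one player. -/
abbrev LocalBits {m : ℕ} (own : Fin m → Player) (p : Player) : Type :=
  {q : Fin m // own q = p} → Bool

/-- The state of the qubits of one player. -/
abbrev LocalState {m : ℕ} (own : Fin m → Player) (p : Player) : Type := LocalBits own p → ℂ

section product

variable {m : ℕ} (own : Fin m → Player)

/-- The product state of states of the two players. -/
def product (A : LocalState own Player.alice) (B : LocalState own Player.bob) : QState m :=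
  fun a => A (fun q => a q) * B (fun q => a q)

/-- A bit string is given by its parts on the qubits of the two players. -/
def splitBits : Bits m ≃ LocalBits own Player.alice × LocalBits own Player.bob where
  toFun a := (fun q => a q, fun q => a q)
  invFun w q := if h : own q = Player.alice then w.1 ⟨q, h⟩
    else w.2 ⟨q, Player.eq_bob_of_ne h⟩
  left_inv a := by funext q; simp
  right_inv w := by
    refine Prod.ext (funext fun q => ?_) (funext fun q => ?_)
    · simp [q.2]
    · simp [q.2]

theorem sum_splitBits (F : LocalState own Player.alice) (G : LocalState own Player.bob) :
    ∑ a : Bits m, F (fun q => a q) * G (fun q => a q) = (∑ u, F u) * ∑ w, G w := by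
  rw [Finset.sum_mul_sum, ← Fintype.sum_prod_type', ← (splitBits own).sum_comp]
  rfl

theorem localOp_alice_product (U : Matrix (LocalBits own Player.alice)
    (LocalBits own Player.alice) ℂ) (A : LocalState own Player.alice)
    (B : LocalState own Player.bob) :
    (localOp (fun q => own q = Player.alice) U).mulVec (product own A B) =
      product own (U.mulVec A) B := by
  funext a
  rw [localOp_mulVec, product, Matrix.mulVec, dotProduct, Finset.sum_mul]
  refine Finset.sum_congr rfl fun u _ => ?_
  rw [product, ← mul_assoc]
  congr 3
  · funext q; simp [glue, q.2]
  · funext q; simp [glue, q.2]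

theorem localOp_bob_product (U : Matrix (LocalBits own Player.bob)
    (LocalBits own Player.bob) ℂ) (A : LocalState own Player.alice)
    (B : LocalState own Player.bob) :
    (localOp (fun q => own q = Player.bob) U).mulVec (product own A B) =
      product own A (U.mulVec B) := by
  funext a
  rw [localOp_mulVec, product, Matrix.mulVec, dotProduct, Finset.mul_sum]
  refine Finset.sum_congr rfl fun u _ => ?_
  rw [product, mul_left_comm]
  congr 3
  · funext q; simp [glue, q.2]
  · funext q; simp [glue, q.2]

variable {own} {own' : Fin m → Player}

/-- The component of a player's state for the value `b` of the qubit `q`, when the ownership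
of `q` changes: the player who loses `q` keeps the component of his state where `q` is `b`, and
the other player gets `q` in the state `b`. -/
def transfer (own' : Fin m → Player) (q : Fin m) (b : Bool) {p : Player} (A : LocalState own p) :
    LocalState own' p := fun u =>
  -- Vacuous for the player without `q`; for the new owner it is the factor `|b⟩`.
  if ∀ h : own' q = p, u ⟨q, h⟩ = b then
    A fun q' => if h : own' q' = p then u ⟨q', h⟩ else b
  else 0

/-- This inserts `|1⟩⟨1| + |0⟩⟨0|` at the qubit `q`: after the transfer the state is a sum of two
products with respect to the new ownership. -/
theorem product_eq_transfer {q : Fin m} (h : ∀ q', q' ≠ q → own' q' = own q')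
    (A : LocalState own Player.alice) (B : LocalState own Player.bob) :
    product own A B =
      product own' (transfer own' q true A) (transfer own' q true B) +
        product own' (transfer own' q false A) (transfer own' q false B) := by
  funext a
  have same : product own' (transfer own' q (a q) A) (transfer own' q (a q) B) a =
      product own A B a := by
    have ext : ∀ p, (fun q' : {q' // own q' = p} =>
        if own' q' = p then a q' else a q) = fun q' : {q' // own q' = p} => a q' := by
      intro p
      funext q'
      split_ifs with h'
      · rfl
      · by_cases hq : q'.1 = q
        · rw [hq]
        · exact absurd ((h q' hq).trans q'.2) h'
    simp [product, transfer, ext]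
  have diff : product own' (transfer own' q (!a q) A) (transfer own' q (!a q) B) a = 0 := by
    rcases hp : own' q with _ | _ <;> simp [product, transfer, hp]
  rw [Pi.add_apply]
  rcases ha : a q with _ | _ <;> rw [ha] at same diff <;> simp only [Bool.not_true,
    Bool.not_false] at diff
  · rw [diff, same, zero_add]
  · rw [diff, same, add_zero]

/-- The nonzero entries are entries of `A` at distinct places. This keeps the factors bounded by `1`
through all rounds. -/
theorem sum_norm_sq_transfer_le {q : Fin m} (h : ∀ q', q' ≠ q → own' q' = own q') (b : Bool)
    {p : Player} (A : LocalState own p) :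
    ∑ u, ‖transfer own' q b A u‖ ^ 2 ≤ ∑ u, ‖A u‖ ^ 2 := by
  classical
  let s := Finset.univ.filter fun u : LocalBits own' p => ∀ h : own' q = p, u ⟨q, h⟩ = b
  let E : LocalBits own' p → LocalBits own p := fun u q' =>
    if h : own' q' = p then u ⟨q', h⟩ else b
  have e : ∑ u, ‖transfer own' q b A u‖ ^ 2 = ∑ u ∈ s, ‖A (E u)‖ ^ 2 := by
    rw [Finset.sum_filter]
    refine Finset.sum_congr rfl fun u _ => ?_
    unfold transfer
    split_ifs <;> simp [E]
  have inj : Set.InjOn E s := by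
    intro u hu u' hu' huu
    simp only [s, Finset.coe_filter, Finset.mem_univ, true_and, Set.mem_ofPred_eq] at hu hu'
    funext ⟨q', hq'⟩
    by_cases hq : q' = q
    · subst hq
      rw [hu hq', hu' hq']
    · have := congrFun huu ⟨q', (h q' hq).symm.trans hq'⟩
      simpa [E, hq'] using this
  rw [e, ← Finset.sum_image (f := fun u => ‖A u‖ ^ 2) inj]
  exact Finset.sum_le_univ_sum_of_nonneg fun _ => by positivity

end product

/-! ### The acceptance probability as a short sum of product functions -/

namespace QRounds

variable {m : ℕ}

/-- The sesquilinear form in the state whose quadratic form is the output probability. -/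
noncomputable def form : {own : Fin m → Player} → QRounds m own → QState m → QState m → Bool → ℂ
  | _, measure q, ψ, φ, v => ∑ a : Bits m, if a q = v then (starRingEnd ℂ) (ψ a) * φ a else 0
  | own, round p U _ _ rest, ψ, φ, v =>
      rest.form ((localOp (fun q => own q = p) U.1).mulVec ψ)
        ((localOp (fun q => own q = p) U.1).mulVec φ) v

/-- Unlike the probability, the form is additive in each argument, so it can follow the splitting of
the state. -/
theorem form_self {own : Fin m → Player} (R : QRounds m own) (ψ : QState m) (v : Bool) :
    R.form ψ ψ v = R.prob ψ v := by
  induction R generalizing ψ with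
  | measure q =>
    simp only [form, prob, Complex.ofReal_sum, Complex.conj_mul']
    refine Finset.sum_congr rfl fun a _ => ?_
    split_ifs <;> simp
  | round p U q hq rest ih => exact ih _

theorem form_add_left {own : Fin m → Player} (R : QRounds m own) (ψ ψ' φ : QState m) (v : Bool) :
    R.form (ψ + ψ') φ v = R.form ψ φ v + R.form ψ' φ v := by
  induction R generalizing ψ ψ' φ with
  | measure q =>
    simp only [form, ← Finset.sum_add_distrib]
    refine Finset.sum_congr rfl fun a _ => ?_
    split_ifs <;> simp [add_mul]
  | round p U q hq rest ih => simp only [form, Matrix.mulVec_add, ih]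

theorem form_add_right {own : Fin m → Player} (R : QRounds m own) (ψ φ φ' : QState m)
    (v : Bool) : R.form ψ (φ + φ') v = R.form ψ φ v + R.form ψ φ' v := by
  induction R generalizing ψ φ φ' with
  | measure q =>
    simp only [form, ← Finset.sum_add_distrib]
    refine Finset.sum_congr rfl fun a _ => ?_
    split_ifs <;> simp [mul_add]
  | round p U q hq rest ih => simp only [form, Matrix.mulVec_add, ih]

theorem prob_nonneg {own : Fin m → Player} (R : QRounds m own) (ψ : QState m) (v : Bool) :
    0 ≤ R.prob ψ v := by
  induction R generalizing ψ with
  | measure q => exact Finset.sum_nonneg fun a _ => by split_ifs <;> positivity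
  | round p U q hq rest ih => exact ih _

theorem prob_true_add_prob_false {own : Fin m → Player} (R : QRounds m own) (ψ : QState m) :
    R.prob ψ true + R.prob ψ false = ∑ a, ‖ψ a‖ ^ 2 := by
  induction R generalizing ψ with
  | measure q =>
    simp only [prob, ← Finset.sum_add_distrib]
    refine Finset.sum_congr rfl fun a _ => ?_
    cases a q <;> simp
  | round p U q hq rest ih =>
    simp only [prob, ih, sum_norm_sq_localOp]

theorem norm_sum_ite_conj_mul_le {κ : Type*} [Fintype κ] (s : κ → Prop) [DecidablePred s]
    {A A' : κ → ℂ} (hA : ∑ u, ‖A u‖ ^ 2 ≤ 1) (hA' : ∑ u, ‖A' u‖ ^ 2 ≤ 1) :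
    ‖∑ u, if s u then (starRingEnd ℂ) (A u) * A' u else 0‖ ≤ 1 := by
  calc ‖∑ u, if s u then (starRingEnd ℂ) (A u) * A' u else 0‖
      ≤ ∑ u, (‖A u‖ ^ 2 + ‖A' u‖ ^ 2) / 2 := by
        refine norm_sum_le_of_le _ fun u _ => ?_
        split_ifs
        · rw [norm_mul, RCLike.norm_conj]
          nlinarith [sq_nonneg (‖A u‖ - ‖A' u‖)]
        · simp only [norm_zero]; positivity
    _ ≤ 1 := by rw [← Finset.sum_div, Finset.sum_add_distrib]; linarith

/-- A local unitary preserves products, and sending a qubit splits both arguments in two, hence the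
factor `4` per round. The two arguments are independent because cross terms `b ≠ b'` arise. In the
end the measured qubit belongs to one player, so the form factors. -/
theorem form_product {own : Fin m → Player} (R : QRounds m own) (v : Bool) {X Y : Type*}
    (A A' : X → LocalState own Player.alice) (B B' : Y → LocalState own Player.bob)
    (hA : ∀ x, ∑ u, ‖A x u‖ ^ 2 ≤ 1) (hA' : ∀ x, ∑ u, ‖A' x u‖ ^ 2 ≤ 1)
    (hB : ∀ y, ∑ u, ‖B y u‖ ^ 2 ≤ 1) (hB' : ∀ y, ∑ u, ‖B' y u‖ ^ 2 ≤ 1) :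
    IsProductSum (4 ^ R.cost) fun x y =>
      R.form (product own (A x) (B y)) (product own (A' x) (B' y)) v := by
  induction R with
  | @measure own q =>
    have e : ∀ x y, (measure q : QRounds m own).form (product own (A x) (B y))
        (product own (A' x) (B' y)) v =
        (∑ u, if ∀ h : own q = Player.alice, u ⟨q, h⟩ = v then
          (starRingEnd ℂ) (A x u) * A' x u else 0) *
        ∑ w, if ∀ h : own q = Player.bob, w ⟨q, h⟩ = v then
          (starRingEnd ℂ) (B y w) * B' y w else 0 := by
      intro x y
      rw [← sum_splitBits, form]
      refine Finset.sum_congr rfl fun a _ => ?_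
      have hq : own q = Player.alice ∨ own q = Player.bob := by cases own q <;> simp
      rcases hq with hq | hq <;> by_cases ha : a q = v <;> simp [product, hq, ha] <;> ring
    simp only [e]
    exact .of_mul _ _ (fun x => norm_sum_ite_conj_mul_le _ (hA x) (hA' x))
      (fun y => norm_sum_ite_conj_mul_le _ (hB y) (hB' y))
  | @round own p U q hq rest ih =>
    have key : ∀ (A A' : X → LocalState own Player.alice) (B B' : Y → LocalState own Player.bob),
        (∀ x, ∑ u, ‖A x u‖ ^ 2 ≤ 1) → (∀ x, ∑ u, ‖A' x u‖ ^ 2 ≤ 1) →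
        (∀ y, ∑ u, ‖B y u‖ ^ 2 ≤ 1) → (∀ y, ∑ u, ‖B' y u‖ ^ 2 ≤ 1) →
        IsProductSum (4 ^ (rest.cost + 1)) fun x y =>
          rest.form (product own (A x) (B y)) (product own (A' x) (B' y)) v := by
      intro A A' B B' hA hA' hB hB'
      have h : ∀ q', q' ≠ q → Function.update own q p.other q' = own q' := fun q' hq' => Function.update_of_ne hq' _ _
      have step : ∀ b b', IsProductSum (4 ^ rest.cost) fun x y => rest.form
          (product _ (transfer _ q b (A x)) (transfer _ q b (B y)))
          (product _ (transfer _ q b' (A' x)) (transfer _ q b' (B' y))) v := fun b b' =>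
        ih _ _ _ _ (fun x => (sum_norm_sq_transfer_le h b _).trans (hA x))
          (fun x => (sum_norm_sq_transfer_le h b' _).trans (hA' x))
          (fun y => (sum_norm_sq_transfer_le h b _).trans (hB y))
          (fun y => (sum_norm_sq_transfer_le h b' _).trans (hB' y))
      have := ((step true true).add (step false true)).add
        ((step true false).add (step false false)) |>.mono (R' := 4 ^ (rest.cost + 1))
          (by rw [pow_succ]; omega)
      simp only [product_eq_transfer h, form_add_left, form_add_right]
      exact this
    cases p with
    | alice =>
      simp only [form, localOp_alice_product, cost]
      exact key _ _ _ _ (fun x => (sum_norm_sq_mulVec_unitary U _).trans_le (hA x))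
        (fun x => (sum_norm_sq_mulVec_unitary U _).trans_le (hA' x)) hB hB'
    | bob =>
      simp only [form, localOp_bob_product, cost]
      exact key _ _ _ _ hA hA' (fun x => (sum_norm_sq_mulVec_unitary U _).trans_le (hB x))
        (fun x => (sum_norm_sq_mulVec_unitary U _).trans_le (hB' x))

end QRounds

namespace QProtocol

variable {n : ℕ} (P : QProtocol n)

theorem initBits_alice {q : Fin P.m} (hq : P.own q = Player.alice) (x y y' : Bits n) :
    P.initBits x y q = P.initBits x y' q := by
  have : ∀ i, P.inB i ≠ q := by
    rintro i rfl
    rw [P.own_inB] at hq; cases hq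
  simp [initBits, this]

theorem initBits_bob {q : Fin P.m} (hq : P.own q = Player.bob) (x x' y : Bits n) :
    P.initBits x y q = P.initBits x' y q := by
  have : ∀ i, P.inA i ≠ q := by
    rintro i rfl
    rw [P.own_inA] at hq; cases hq
  simp [initBits, this]

theorem sum_norm_sq_single {κ : Type*} [Fintype κ] [DecidableEq κ] (k : κ) :
    ∑ u, ‖(Pi.single k 1 : κ → ℂ) u‖ ^ 2 = 1 := by
  rw [Finset.sum_eq_single k] <;> simp +contextual

/-- Neither player's qubits depend on the other's input, so an arbitrary `z` stands in for it. -/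
theorem initState_eq_product (x y z : Bits n) :
    P.initState x y = product P.own (Pi.single (fun q => P.initBits x z q) 1)
      (Pi.single (fun q => P.initBits z y q) 1) := by
  funext a
  have h : a = P.initBits x y ↔ (fun q : {q // P.own q = Player.alice} => a q) =
      (fun q : {q // P.own q = Player.alice} => P.initBits x z q) ∧ (fun q : {q // P.own q = Player.bob} => a q) =
      (fun q : {q // P.own q = Player.bob} => P.initBits z y q) := by
    refine ⟨?_, fun ⟨h1, h2⟩ => ?_⟩
    · rintro rfl
      exact ⟨funext fun q => P.initBits_alice q.2 _ _ _, funext fun q => P.initBits_bob q.2 _ _ _⟩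
    · funext q
      rcases hq : P.own q with _ | _
      · exact (congrFun h1 ⟨q, hq⟩).trans (P.initBits_alice hq _ _ _)
      · exact (congrFun h2 ⟨q, hq⟩).trans (P.initBits_bob hq _ _ _)
  simp only [initState, product, Pi.single_apply, h, ite_and]
  split_ifs <;> simp

theorem isProductSum_prob (v : Bool) :
    IsProductSum (4 ^ P.rounds.cost) fun x y => (P.prob x y v : ℂ) := by
  simp only [prob, ← QRounds.form_self, P.initState_eq_product _ _ fun _ => false]
  exact P.rounds.form_product v _ _ _ _ (fun _ => (sum_norm_sq_single _).le)
    (fun _ => (sum_norm_sq_single _).le) (fun _ => (sum_norm_sq_single _).le)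
    (fun _ => (sum_norm_sq_single _).le)

theorem prob_nonneg (x y : Bits n) (v : Bool) : 0 ≤ P.prob x y v := P.rounds.prob_nonneg _ _

theorem prob_true_add_prob_false (x y : Bits n) : P.prob x y true + P.prob x y false = 1 :=
  (P.rounds.prob_true_add_prob_false _).trans (sum_norm_sq_single _)

theorem prob_of_cost_eq_zero (h : P.rounds.cost = 0) :
    ∃ q, ∀ x y v, P.prob x y v = if P.initBits x y q = v then 1 else 0 := by
  unfold prob
  generalize P.rounds = R at h
  cases R with
  | measure q =>
    refine ⟨q, fun x y v => ?_⟩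
    rw [QRounds.prob, Finset.sum_eq_single (P.initBits x y)]
    · simp [initState]
    · intro a _ ha
      simp [initState, ha]
    · simp
  | round p U q hq rest => simp [QRounds.cost] at h

/-- Without communication, the output probabilities depend on one of the inputs only. -/
theorem prob_eq_or_prob_eq_of_cost_eq_zero (h : P.rounds.cost = 0) :
    (∀ x y y' v, P.prob x y v = P.prob x y' v) ∨ ∀ x x' y v, P.prob x y v = P.prob x' y v := by
  obtain ⟨q, hq⟩ := P.prob_of_cost_eq_zero h
  rcases hp : P.own q with _ | _
  · exact .inl fun x y y' v => by rw [hq, hq, P.initBits_alice hp x y y']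
  · exact .inr fun x x' y v => by rw [hq, hq, P.initBits_bob hp x x' y]

end QProtocol

/-! ### A fingerprinting protocol -/

/-- Alice sends `g x` bit by bit. A leaf sees only the transcript, so Bob has to send the answer as
one more bit. -/
theorem Protocol.exists_send {X Y : Type} {ℓ : ℕ} (g : X → Bits ℓ) (h : Y → Bits ℓ → Bool) :
    ∃ p : Protocol X Y, p.cost ≤ ℓ + 1 ∧ ∀ x y, p.run x y = h y (g x) := by
  induction ℓ with
  | zero =>
    refine ⟨.bob (fun y => h y Fin.elim0) (.output true) (.output false), by simp [cost], ?_⟩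
    intro x y
    rw [Subsingleton.elim (g x) Fin.elim0]
    by_cases hy : h y Fin.elim0 = true <;> simp [run, hy]
  | succ ℓ ih =>
    obtain ⟨p₁, hc₁, hp₁⟩ := ih (fun x i => g x i.succ) (fun y w => h y (Fin.cons true w))
    obtain ⟨p₀, hc₀, hp₀⟩ := ih (fun x i => g x i.succ) (fun y w => h y (Fin.cons false w))
    refine ⟨.alice (fun x => g x 0) p₁ p₀, by simp [cost]; omega, ?_⟩
    intro x y
    rw [run, hp₁, hp₀]
    have e : g x = Fin.cons (g x 0) (fun i => g x i.succ) := (Fin.cons_self_tail (g x)).symm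
    conv_rhs => rw [e]
    cases g x 0 <;> simp

section fingerprint

variable {F : Type*} [Field F] {n : ℕ}

open Polynomial in
/-- The polynomial whose coefficients are the bits of `x`. -/
noncomputable def bitPoly (F : Type*) [Field F] {n : ℕ} (x : Bits n) : F[X] :=
  ∑ i : Fin n, C (if x i then 1 else 0) * X ^ (i : ℕ)

theorem bitPoly_degree_lt (x : Bits n) : (bitPoly F x).degree < n := by
  refine (Polynomial.degree_sum_fin_lt _)

theorem bitPoly_injective : Function.Injective (bitPoly F (n := n)) := by
  intro x y h
  funext i
  have hc : ∀ z : Bits n, (bitPoly F z).coeff i = if z i then 1 else 0 := by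
    intro z
    simp only [bitPoly, Polynomial.finsetSum_coeff, Polynomial.coeff_C_mul_X_pow, Fin.val_inj]
    simp
  have := congrArg (fun p => p.coeff i) h
  simp only [hc] at this
  cases hx : x i <;> cases hy : y i <;> simp_all

/-- Different strings have the same fingerprint for less than `n` keys. -/
theorem card_eval_bitPoly_eq_le [Fintype F] [DecidableEq F] {x y : Bits n} (h : x ≠ y) :
    (Finset.univ.filter fun r : F => (bitPoly F x).eval r = (bitPoly F y).eval r).card ≤ n := by
  set p := bitPoly F x - bitPoly F y with hp
  have h0 : p ≠ 0 := sub_ne_zero.2 fun e => h (bitPoly_injective e)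
  have hdeg : p.degree < n := (Polynomial.degree_sub_le _ _).trans_lt
    (max_lt (bitPoly_degree_lt x) (bitPoly_degree_lt y))
  calc _ ≤ p.roots.toFinset.card := by
        refine Finset.card_le_card fun r hr => ?_
        simp only [Finset.mem_filter, Finset.mem_univ, true_and] at hr
        rw [Multiset.mem_toFinset, Polynomial.mem_roots h0]
        simp [hp, hr]
    _ ≤ p.roots.card := Multiset.toFinset_card_le _
    _ ≤ p.natDegree := Polynomial.card_roots' p
    _ ≤ n := (Polynomial.natDegree_lt_iff_degree_lt h0 |>.2 hdeg).le

end fingerprint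

/-- If `2 ^ a` is large enough, it suffices to communicate `2 * a + 1` bits. -/
theorem BPC_HAM_le {n t a : ℕ} (ha : a ≠ 0) (h : 3 * (n ^ t * n) ≤ 2 ^ a) :
    BPC (HAM n t) ≤ (a + a + 1 : ℕ) := by
  classical
  -- With `2 ^ a` elements, `a` fair bits give a uniform key and a fingerprint takes exactly `a`
  -- bits.
  let F := GaloisField 2 a
  have : Finite F := Nat.finite_of_card_ne_zero (by rw [GaloisField.card 2 a ha]; positivity)
  let _ : Fintype F := Fintype.ofFinite F
  have hF : Fintype.card F = 2 ^ a := by rw [← Nat.card_eq_fintype_card, GaloisField.card 2 a ha]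
  let e : Bits a ≃ F := Fintype.equivOfCardEq (by simp [hF])
  let fp : Bits n → F → F := fun x r => (bitPoly F x).eval r
  obtain ⟨p, hpc, hpr⟩ := Protocol.exists_send
    (X := Bits n × Bits a) (Y := Bits n × Bits 0) (ℓ := a + a)
    (fun z => Fin.append z.2 (e.symm (fp z.1 (e z.2))))
    (fun z w => decide (¬ ∃ y', hammingDist z.1 y' = t ∧
      fp y' (e fun i => w (Fin.castAdd a i)) = e fun i => w (Fin.natAdd a i)))
  have hrun : ∀ x y r s, p.run (x, r) (y, s) =
      decide (¬ ∃ y', hammingDist y y' = t ∧ fp y' (e r) = fp x (e r)) := by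
    intro x y r s
    rw [hpr]
    simp only [Fin.append_left, Fin.append_right, Equiv.apply_symm_apply]
  let P : RandomizedProtocol n := ⟨a, 0, p⟩
  have hprob : ∀ x y, 1 - 1 / 3 ≤ P.prob x y (HAM n t x y) := by
    intro x y
    let bad : Finset (Bits a × Bits 0) := Finset.univ.filter fun r =>
      ¬ p.run (x, r.1) (y, r.2) = HAM n t x y
    -- The error is one-sided: at distance `t` the string `x` itself is found. Otherwise a bad key
    -- makes `x` collide with some string on the sphere around `y`.
    have hbad : 3 * bad.card ≤ 2 ^ a := by
      by_cases hxy : hammingDist x y = t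
      · have : bad = ∅ := by
          refine Finset.filter_eq_empty_iff.2 fun r _ => ?_
          rw [not_not, hrun]
          have : ∃ y', hammingDist y y' = t ∧ fp y' (e r.1) = fp x (e r.1) :=
            ⟨x, by rw [hammingDist_comm]; exact hxy, rfl⟩
          simp [HAM, hxy, this]
        simp [this]
      · let near := Finset.univ.filter fun y' : Bits n => hammingDist y y' = t
        have hsub : bad.image (fun r => e r.1) ⊆ near.biUnion fun y' =>
            Finset.univ.filter fun r => fp y' r = fp x r := by
          intro r hr
          obtain ⟨r, hr', rfl⟩ := Finset.mem_image.1 hr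
          replace hr := (Finset.mem_filter.1 hr').2
          rw [hrun] at hr
          simpa [HAM, hxy, near] using hr
        have hinj : Function.Injective fun r : Bits a × Bits 0 => e r.1 := by
          intro r r' hr
          exact Prod.ext (e.injective hr) (Subsingleton.elim _ _)
        have : bad.card ≤ n ^ t * n := by
          rw [← Finset.card_image_of_injective bad hinj]
          calc _ ≤ _ := Finset.card_le_card hsub
            _ ≤ near.card * n := Finset.card_biUnion_le_card_mul _ _ _ fun y' hy' => by
                refine card_eval_bitPoly_eq_le ?_
                rintro rfl
                exact hxy (by simpa [near, hammingDist_comm] using hy')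
            _ ≤ n ^ t * n := by
                rw [card_hammingDist_eq]
                exact Nat.mul_le_mul_right _ (Nat.choose_le_pow _ _)
        omega
    have hcard : Fintype.card (Bits a × Bits 0) = 2 ^ a := by simp
    have hsum := Finset.card_filter_add_card_filter_not (s := Finset.univ)
      (fun r : Bits a × Bits 0 => p.run (x, r.1) (y, r.2) = HAM n t x y)
    rw [Finset.card_univ, hcard] at hsum
    have hsum' : ((Finset.univ.filter fun r : Bits a × Bits 0 =>
      p.run (x, r.1) (y, r.2) = HAM n t x y).card : ℝ) + bad.card = 2 ^ a := by exact_mod_cast hsum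
    have hbad' : 3 * (bad.card : ℝ) ≤ 2 ^ a := by exact_mod_cast hbad
    have hgoal : P.prob x y (HAM n t x y) = ((Finset.univ.filter fun r : Bits a × Bits 0 =>
      p.run (x, r.1) (y, r.2) = HAM n t x y).card : ℝ) / 2 ^ a := by
      rw [RandomizedProtocol.prob]
      congr 1
      exact_mod_cast hcard
    rw [hgoal, le_div_iff₀ (by positivity)]
    linarith
  calc BPC (HAM n t) ≤ (P.tree.cost : ℕ∞) := iInf₂_le P hprob
    _ ≤ (a + a + 1 : ℕ) := by exact_mod_cast hpc

theorem BPC_HAM_le_logb {n : ℕ} (hn : 2 ≤ n) (t : ℕ) :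
    (BPC (HAM n t) : ℝ≥0∞) ≤ ENNReal.ofReal (13 * (max (t : ℝ) 1 * Real.logb 2 n)) := by
  set a := Nat.clog 2 (3 * (n ^ t * n)) with ha
  have hpos : 1 < 3 * (n ^ t * n) := by
    have : 0 < n ^ t * n := by positivity
    omega
  have ha0 : a ≠ 0 := (Nat.clog_pos (by norm_num) hpos).ne'
  have h1 := BPC_HAM_le ha0 (Nat.le_pow_clog (by norm_num) _)
  have hlog : 1 ≤ Real.logb 2 n := by
    rw [Real.le_logb_iff_rpow_le (by norm_num) (by positivity)]
    simpa using (by exact_mod_cast hn : (2 : ℝ) ≤ n)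
  have hle : (a : ℝ) ≤ 3 + (t + 1) * Real.logb 2 n := by
    have hlt : 2 ^ (a - 1) < 3 * (n ^ t * n) := Nat.pow_pred_clog_lt_self (by norm_num) hpos
    have hle : 2 ^ a ≤ 8 * n ^ (t + 1) := by
      obtain ⟨b, hb⟩ := Nat.exists_eq_succ_of_ne_zero ha0
      rw [hb] at hlt ⊢
      simp only [Nat.succ_eq_add_one, Nat.add_sub_cancel] at hlt
      rw [Nat.succ_eq_add_one, pow_succ, pow_succ]
      omega
    have hle' : (2 : ℝ) ^ a ≤ 8 * (n : ℝ) ^ (t + 1) := by exact_mod_cast hle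
    have := Real.logb_le_logb_of_le (b := 2) (by norm_num) (by positivity) hle'
    rw [Real.logb_mul (by norm_num) (by positivity), Real.logb_pow, Real.logb_pow,
      show (8 : ℝ) = 2 ^ 3 by norm_num, Real.logb_pow, Real.logb_self_eq_one (by norm_num)] at this
    push_cast at this
    linarith
  -- The left side is at most `7 + 2 * (t + 1) * log n`, so even `11` would do.
  have h2 : ((a + a + 1 : ℕ) : ℝ) ≤ 13 * (max (t : ℝ) 1 * Real.logb 2 n) := by
    have m1 : (t : ℝ) ≤ max (t : ℝ) 1 := le_max_left _ _
    have m2 : 1 ≤ max (t : ℝ) 1 := le_max_right _ _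
    push_cast
    nlinarith [mul_le_mul_of_nonneg_right m1 (by linarith : 0 ≤ Real.logb 2 n),
      mul_le_mul m2 hlog (by norm_num) (by linarith),
      mul_le_mul_of_nonneg_right m2 (by linarith : 0 ≤ Real.logb 2 n)]
  calc (BPC (HAM n t) : ℝ≥0∞) ≤ (((a + a + 1 : ℕ) : ℕ∞) : ℝ≥0∞) := by
        exact_mod_cast ENat.toENNReal_le.2 h1
    _ = ENNReal.ofReal ((a + a + 1 : ℕ) : ℝ) := by rw [ENNReal.ofReal_natCast]; simp
    _ ≤ _ := ENNReal.ofReal_le_ofReal h2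

/-! ### The lower bounds for quantum protocols -/

theorem hammingDist_append {k l : ℕ} (x y : Bits k) (u v : Bits l) :
    hammingDist (Fin.append x u) (Fin.append y v) = hammingDist x y + hammingDist u v := by
  simp only [hammingDist, Finset.card_filter, Fin.sum_univ_add, Fin.append_left,
    Fin.append_right]

namespace QProtocol

section correct

variable {n t : ℕ} {P : QProtocol n} (hP : ∀ x y, 1 - 1 / 3 ≤ P.prob x y (HAM n t x y))
include hP

theorem le_prob_false {x y : Bits n} (h : hammingDist x y = t) : 2 / 3 ≤ P.prob x y false := by
  have := hP x y
  simp only [HAM, h, ne_eq, not_true_eq_false, decide_false] at this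
  linarith

theorem prob_false_le {x y : Bits n} (h : hammingDist x y ≠ t) : P.prob x y false ≤ 1 / 3 := by
  have := hP x y
  simp only [HAM, h, ne_eq, not_false_eq_true, decide_true] at this
  linarith [P.prob_true_add_prob_false x y]

end correct

section equality

variable {k t : ℕ} {P : QProtocol (k + t)}
  (hP : ∀ x y, 1 - 1 / 3 ≤ P.prob x y (HAM (k + t) t x y))
include hP

/-- The Hamming distance problem contains the equality problem on `k` bits. -/
theorem le_prob_append_self (x : Bits k) :
    2 / 3 ≤ P.prob (Fin.append x fun _ => false) (Fin.append x fun _ => true) false :=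
  le_prob_false hP (by rw [hammingDist_append]; simp [hammingDist])

theorem prob_append_le {x y : Bits k} (h : x ≠ y) :
    P.prob (Fin.append x fun _ => false) (Fin.append y fun _ => true) false ≤ 1 / 3 := by
  refine prob_false_le hP ?_
  rw [hammingDist_append]
  have := hammingDist_pos.2 h
  have : hammingDist (fun _ : Fin t => false) (fun _ => true) = t := by simp [hammingDist]
  omega

/-- Equality on at least one bit depends on both inputs. Positivity lets multiples of the cost
absorb the additive constants below. -/
theorem cost_pos (hk : 0 < k) : 0 < P.rounds.cost := by
  by_contra h0
  have hne : (fun _ : Fin k => false) ≠ fun _ => true := fun h => by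
    simpa using congrFun h ⟨0, hk⟩
  have h1 := le_prob_append_self hP fun _ => false
  have h2 := prob_append_le hP hne
  have h3 := prob_append_le hP hne.symm
  rcases P.prob_eq_or_prob_eq_of_cost_eq_zero (by omega) with h | h
  · rw [h _ _ (Fin.append (fun _ => false) fun _ => true)] at h2
    rw [h _ _ (Fin.append (fun _ => true) fun _ => true)] at h1 h2
    linarith
  · rw [h _ (Fin.append (fun _ => false) fun _ => false)] at h3
    linarith

theorem le_two_pow_cost : k ≤ (4 + 2 * P.rounds.cost) * (2 * 4 ^ P.rounds.cost) := by
  set Q := P.rounds.cost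
  have h := ((P.isProductSum_prob false).comp
    (fun x : Bits k => Fin.append x fun _ => false)
    (fun x : Bits k => Fin.append x fun _ => true)).card_le_of_approx_eq (by positivity)
    (fun x => by simpa only [Complex.ofReal_re] using le_prob_append_self hP x)
    (fun x y hxy => by simpa only [Complex.ofReal_re] using prob_append_le hP hxy)
  rw [Fintype.card_fun, Fintype.card_bool, Fintype.card_fin] at h
  -- With a power of two as base, the count becomes a comparison of exponents.
  have hR : 14 * 4 ^ Q + 1 ≤ 2 ^ (4 + 2 * Q) := by
    have : 2 ^ (4 + 2 * Q) = 16 * 4 ^ Q := by rw [pow_add, pow_mul]; norm_num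
    have : 0 < 4 ^ Q := by positivity
    omega
  have h' := h.trans (Nat.pow_le_pow_left hR _)
  rw [← pow_mul] at h'
  exact (Nat.pow_le_pow_iff_right (by norm_num)).1 h'

theorem logb_le_cost (hk : 0 < k) (ht : t ≤ k) :
    Real.logb 2 (k + t : ℕ) ≤ 7 * P.rounds.cost := by
  have hQ : (1 : ℝ) ≤ P.rounds.cost := by exact_mod_cast cost_pos hP hk
  have h := le_two_pow_cost hP
  set Q := P.rounds.cost
  -- Here `k + t ≤ 2 * k`; the exponent is at most `7 * Q` since `Q ≥ 1`.
  have h1 : k + t ≤ 2 ^ (3 * Q + 4) := by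
    have e : 2 ^ (3 * Q + 4) = 2 ^ (Q + 1) * (8 * 4 ^ Q) := by
      rw [show (4 : ℕ) = 2 ^ 2 by norm_num, show (8 : ℕ) = 2 ^ 3 by norm_num, ← pow_mul, ← pow_add,
        ← pow_add]
      congr 1; omega
    have : Q + 2 ≤ 2 ^ (Q + 1) := Nat.lt_two_pow_self
    calc k + t ≤ 2 * ((4 + 2 * Q) * (2 * 4 ^ Q)) := by omega
      _ = (Q + 2) * (8 * 4 ^ Q) := by ring
      _ ≤ 2 ^ (3 * Q + 4) := by rw [e]; exact Nat.mul_le_mul_right _ this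
  have h2 : ((k + t : ℕ) : ℝ) ≤ 2 ^ (3 * Q + 4) := by exact_mod_cast h1
  have h3 := Real.logb_le_logb_of_le (b := 2) (by norm_num)
    (by exact_mod_cast (by omega : 0 < k + t)) h2
  rw [Real.logb_pow, Real.logb_self_eq_one (by norm_num)] at h3
  push_cast at h3 ⊢
  linarith

end equality

/-- Padding by zeros preserves distances, and the amplified probability of output `false`
approximates the indicator of the sphere. -/
theorem two_pow_mul_le {l t : ℕ} {P : QProtocol (2 * t + l)}
    (hP : ∀ x y, 1 - 1 / 3 ≤ P.prob x y (HAM (2 * t + l) t x y)) (m : ℕ) :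
    2 ^ t * ((Nat.centralBinom t : ℝ) / 4 ^ t - (8 / 9) ^ m) ≤
      (2 * 4 ^ P.rounds.cost) ^ (2 * m) := by
  let pad : Bits (2 * t) → Bits (2 * t + l) := fun x => Fin.append x fun _ => false
  have hpad : ∀ x y, hammingDist (pad x) (pad y) = hammingDist x y := fun x y => by
    simp [pad, hammingDist_append]
  have h := ((P.isProductSum_prob false).comp pad pad).majority
    ((P.isProductSum_prob true).comp pad pad) m
  refine (h.le_of_approx_sphere fun x y => ?_).trans (by push_cast; rfl)
  have hsum : P.prob (pad x) (pad y) false + P.prob (pad x) (pad y) true = 1 := by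
    rw [add_comm]; exact P.prob_true_add_prob_false _ _
  have h0 := P.prob_nonneg (pad x) (pad y) false
  have h1 := P.prob_nonneg (pad x) (pad y) true
  by_cases hxy : hammingDist x y = t
  · have := le_prob_false hP ((hpad x y).trans hxy)
    have b1 := majority_le_one m h0 h1 hsum
    have b2 := one_sub_majority_le m h1 hsum (by linarith)
    rw [if_pos hxy, ← Complex.ofReal_one, ← Complex.ofReal_sub, Complex.norm_real,
      Real.norm_eq_abs, abs_sub_comm, abs_of_nonneg (by linarith)]
    exact b2
  · have := prob_false_le hP (x := pad x) (y := pad y) (by rwa [hpad])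
    have b1 := majority_nonneg m h0 h1
    have b2 := majority_le m h0 hsum this
    rw [if_neg hxy, sub_zero, Complex.norm_real, Real.norm_eq_abs, abs_of_nonneg b1]
    exact b2

theorem div_logb_le_cost {l t : ℕ} (ht : 2 ≤ t) {P : QProtocol (2 * t + l)}
    (hP : ∀ x y, 1 - 1 / 3 ≤ P.prob x y (HAM (2 * t + l) t x y)) (hQ : 0 < P.rounds.cost) :
    (t : ℝ) / Real.logb 2 t ≤ 148 * P.rounds.cost := by
  -- The target error `2 ^ (-L) ≤ 1 / (4t)` is half of the lower bound `1 / (2t)` for the density;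
  -- `6 * L` serves because `(8 / 9) ^ 6 < 1 / 2`.
  set L := Nat.clog 2 (4 * t) with hL
  have hL1 : 4 * t ≤ 2 ^ L := Nat.le_pow_clog (by norm_num) _
  have hL2 : 2 ^ L ≤ 8 * t := by
    have h0 : L ≠ 0 := (Nat.clog_pos (by norm_num) (by omega)).ne'
    have hlt : 2 ^ (L - 1) < 4 * t := Nat.pow_pred_clog_lt_self (by norm_num) (by omega)
    obtain ⟨b, hb⟩ := Nat.exists_eq_succ_of_ne_zero h0
    rw [hb] at hlt ⊢
    simp only [Nat.succ_eq_add_one, Nat.add_sub_cancel] at hlt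
    rw [Nat.succ_eq_add_one, pow_succ]
    omega
  have h := two_pow_mul_le hP (6 * L)
  set Q := P.rounds.cost
  have ht0 : (0 : ℝ) < t := by exact_mod_cast (by omega : 0 < t)
  have hL1' : 4 * (t : ℝ) ≤ 2 ^ L := by exact_mod_cast hL1
  have h1 : 1 / (2 * t : ℝ) ≤ (Nat.centralBinom t : ℝ) / 4 ^ t := by
    rw [div_le_div_iff₀ (by positivity) (by positivity), one_mul]
    have := Nat.four_pow_le_two_mul_self_mul_centralBinom t (by omega)
    calc (4 : ℝ) ^ t ≤ 2 * t * t.centralBinom := by exact_mod_cast this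
      _ = t.centralBinom * (2 * t) := by ring
  have h2 : (8 / 9 : ℝ) ^ (6 * L) ≤ 1 / (4 * t) := by
    calc (8 / 9 : ℝ) ^ (6 * L) = ((8 / 9) ^ 6) ^ L := pow_mul _ _ _
      _ ≤ (1 / 2) ^ L := by gcongr; norm_num
      _ = 1 / 2 ^ L := by rw [div_pow, one_pow]
      _ ≤ 1 / (4 * t) := by gcongr
  have h3 : (2 : ℝ) ^ t / 2 ^ L ≤ (2 * 4 ^ Q) ^ (2 * (6 * L)) := by
    calc (2 : ℝ) ^ t / 2 ^ L ≤ 2 ^ t / (4 * t) := by gcongr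
      _ = 2 ^ t * (1 / (2 * t) - 1 / (4 * t)) := by field_simp; norm_num
      _ ≤ 2 ^ t * ((Nat.centralBinom t : ℝ) / 4 ^ t - (8 / 9) ^ (6 * L)) := by gcongr
      _ ≤ _ := h
  have h4 : (2 : ℝ) ^ t ≤ 2 ^ ((1 + 2 * Q) * (2 * (6 * L)) + L) := by
    rw [div_le_iff₀ (by positivity)] at h3
    have e : (2 : ℝ) * 4 ^ Q = 2 ^ (1 + 2 * Q) := by rw [pow_add, pow_mul]; norm_num
    rwa [e, ← pow_mul, ← pow_add] at h3
  have h5 : t ≤ (1 + 2 * Q) * (2 * (6 * L)) + L := (pow_le_pow_iff_right₀ (by norm_num)).1 h4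
  -- The bound is `24 * Q * L + 13 * L`, and `Q ≥ 1`.
  have h6 : (t : ℝ) ≤ 37 * Q * L := by
    have : t ≤ 37 * Q * L := by nlinarith
    exact_mod_cast this
  have hlog : 1 ≤ Real.logb 2 t := by
    rw [Real.le_logb_iff_rpow_le (by norm_num) ht0]
    simpa using (by exact_mod_cast ht : (2 : ℝ) ≤ t)
  have h7 : (L : ℝ) ≤ 4 * Real.logb 2 t := by
    have hL2' : (2 : ℝ) ^ L ≤ 8 * t := by exact_mod_cast hL2
    have := Real.logb_le_logb_of_le (b := 2) (by norm_num) (by positivity) hL2'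
    rw [Real.logb_mul (by norm_num) (by positivity), Real.logb_pow,
      show (8 : ℝ) = 2 ^ 3 by norm_num, Real.logb_pow, Real.logb_self_eq_one (by norm_num)] at this
    push_cast at this
    linarith
  rw [div_le_iff₀ (by linarith)]
  calc (t : ℝ) ≤ 37 * Q * L := h6
    _ ≤ 37 * Q * (4 * Real.logb 2 t) := by gcongr
    _ = 148 * Q * Real.logb 2 t := by ring

theorem le_cost {n t : ℕ} (hn : 2 ≤ n) (ht : 2 * t ≤ n) {P : QProtocol n}
    (hP : ∀ x y, 1 - 1 / 3 ≤ P.prob x y (HAM n t x y)) :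
    (t : ℝ) / Real.logb 2 t + Real.logb 2 n ≤ 155 * P.rounds.cost := by
  have hlog : Real.logb 2 n ≤ 7 * P.rounds.cost ∧ 0 < P.rounds.cost := by
    obtain ⟨k, rfl⟩ := Nat.exists_eq_add_of_le' (by omega : t ≤ n)
    exact ⟨logb_le_cost hP (by omega) (by omega), cost_pos hP (by omega)⟩
  have hdiv : (t : ℝ) / Real.logb 2 t ≤ 148 * P.rounds.cost := by
    rcases lt_or_ge t 2 with h | h
    -- Division by zero yields the value `0` prescribed for `t ≤ 1`.
    · have : Real.logb 2 t = 0 := by interval_cases t <;> simp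
      rw [this, div_zero]
      positivity
    · obtain ⟨l, rfl⟩ := Nat.exists_eq_add_of_le ht
      exact div_logb_le_cost h hP hlog.2
  linarith [hlog.1]

end QProtocol

theorem ofReal_le_BQC {n t : ℕ} (hn : 2 ≤ n) (ht : 2 * t ≤ n) :
    ENNReal.ofReal (1 / 155 * ((t : ℝ) / Real.logb 2 t + Real.logb 2 n)) ≤
      (BQC (HAM n t) : ℝ≥0∞) := by
  set r := 1 / 155 * ((t : ℝ) / Real.logb 2 t + Real.logb 2 n) with hr
  -- The infimum lives in `ℕ∞`, so the real bound is first rounded up.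
  have h : ((⌈r⌉₊ : ℕ) : ℕ∞) ≤ BQC (HAM n t) := by
    refine le_iInf₂ fun P hP => ?_
    have := QProtocol.le_cost hn ht hP
    exact_mod_cast Nat.ceil_le.2 (by linarith : r ≤ P.rounds.cost)
  calc ENNReal.ofReal r ≤ ENNReal.ofReal (⌈r⌉₊ : ℝ) := ENNReal.ofReal_le_ofReal (Nat.le_ceil r)
    _ = (((⌈r⌉₊ : ℕ) : ℕ∞) : ℝ≥0∞) := by rw [ENNReal.ofReal_natCast]; simp
    _ ≤ _ := ENat.toENNReal_le.2 h

end CommComplexity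

theorem theorem5p5 :
    (∃ c : ℝ, 0 < c ∧ ∀ t : ℕ → ℕ, Monotone t → (∀ n, (t n : ℝ) ≤ (n : ℝ) / 2) →
      ∀ n : ℕ, 1 ≤ n →
        ENNReal.ofReal (c * ((t n : ℝ) / Real.logb 2 (t n) + Real.logb 2 n)) ≤
          (CommComplexity.BQC (CommComplexity.HAM n (t n)) : ℝ≥0∞)) ∧
    (∃ C : ℝ, 0 < C ∧ ∀ n : ℕ, 2 ≤ n → ∀ t : ℕ,
      (CommComplexity.BPC (CommComplexity.HAM n t) : ℝ≥0∞) ≤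
        ENNReal.ofReal (C * (max (t : ℝ) 1 * Real.logb 2 n))) := by
  refine ⟨⟨1 / 155, by norm_num, fun t _ ht n hn => ?_⟩,
    13, by norm_num, fun n hn t => CommComplexity.BPC_HAM_le_logb hn t⟩
  have h2 : 2 * t n ≤ n := by
    have := ht n
    rw [le_div_iff₀ (by norm_num)] at this
    rw [mul_comm]
    exact_mod_cast this
  rcases hn.eq_or_lt with rfl | hn
  -- For `n = 1` both terms of the bound vanish.
  · have : t 1 = 0 := by omega
    simp [this]
  · exact CommComplexity.ofReal_le_BQC hn h2
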